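/- Let $G$ be a finite-dimensional real Lie group (not necessarily connected), and let $g$ and $\bar g$ be two left-invariant pseudo-Riemannian metrics on $G$, that is, smooth fields of nondegenerate symmetric bilinear forms, of arbitrary (possibly different) signatures, for which all left translations are isometries. Suppose that $\bar g$ is geodesically equivalent to $g$: every geodesic of $g$ is, after a regular change of parameter, a geodesic of $\bar g$. Then $g$ and $\bar g$ are affinely equivalent: their Levi-Civita connections coincide. -/

import Mathlib

open scoped Manifold ContDiff Topology

noncomputable section

section PseudoRiemannian

variable {E : Type*} [NormedAddCommGroup E] [NormedSpace ℝ E]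
  {H : Type*} [TopologicalSpace H] (I : ModelWithCorners ℝ E H)
  (M : Type*) [TopologicalSpace M] [ChartedSpace H M] [IsManifold I ∞ M]

/-- A smooth pseudo-Riemannian metric on `M`, of arbitrary signature: a smooth field of symmetric
nondegenerate bilinear forms on the tangent spaces. -/
structure PseudoRiemannianMetric where
  /-- The bilinear form on the tangent space at `x`. -/
  form (x : M) : TangentSpace I x →L[ℝ] TangentSpace I x →L[ℝ] ℝ
  symm (x : M) (v w : TangentSpace I x) : form x v w = form x w v
  nondegenerate (x : M) (v : TangentSpace I x) (hv : ∀ w, form x v w = 0) : v = 0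
  contMDiff : ContMDiff I (I.prod 𝓘(ℝ, E →L[ℝ] E →L[ℝ] ℝ)) ∞
    (fun x ↦ Bundle.TotalSpace.mk' (E →L[ℝ] E →L[ℝ] ℝ)
      (E := fun x : M ↦ TangentSpace I x →L[ℝ] TangentSpace I x →L[ℝ] ℝ) x (form x))

variable {I M}

/-- `cov` is a Levi-Civita connection of `g`: it is torsion-free, `∇_X Y - ∇_Y X = [X, Y]`, and
compatible with the metric, `u (g(Y, Z)) = g(∇_u Y, Z) + g(Y, ∇_u Z)`. In Mathlib's convention
`cov Y x u` is the derivative `∇_u Y` at `x`; only vector fields that are differentiable at the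
point considered are meaningful arguments of `cov`. -/
structure PseudoRiemannianMetric.IsLeviCivita (g : PseudoRiemannianMetric I M)
    (cov : CovariantDerivative I E (TangentSpace I : M → Type _)) : Prop where
  torsionFree (X Y : Π x : M, TangentSpace I x) (x : M)
    (hX : MDiffAt (T% X) x) (hY : MDiffAt (T% Y) x) :
    cov Y x (X x) - cov X x (Y x) = VectorField.mlieBracket I X Y x
  metric (Y Z : Π x : M, TangentSpace I x) (x : M)
    (hY : MDiffAt (T% Y) x) (hZ : MDiffAt (T% Z) x) (u : TangentSpace I x) :
    mvfderiv I (fun y ↦ g.form y (Y y) (Z y)) x u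
      = g.form x (cov Y x u) (Z x) + g.form x (Y x) (cov Z x u)

open Bundle FiberBundle in
/-- The Levi-Civita connection is unique: two of them agree on every vector field `Y` at every point
where `Y` is differentiable. Hence the definitions below do not depend on the choice of `cov`. -/
theorem PseudoRiemannianMetric.IsLeviCivita.unique
    {g : PseudoRiemannianMetric I M}
    {cov cov' : CovariantDerivative I E (TangentSpace I : M → Type _)}
    (h : g.IsLeviCivita cov) (h' : g.IsLeviCivita cov')
    (Y : Π x : M, TangentSpace I x) (x : M) (hY : MDiffAt (T% Y) x) : cov Y x = cov' Y x := by
  have hD : ∀ v : TangentSpace I x, MDiffAt (T% (extend E v)) x :=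
    fun v ↦ mdifferentiableAt_extend ..
  have key : ∀ {A B C : Π x : M, TangentSpace I x}, MDiffAt (T% A) x → MDiffAt (T% B) x →
      g.form x (B x) (cov A x (C x) - cov' A x (C x))
        + g.form x (A x) (cov B x (C x) - cov' B x (C x)) = 0 := by
    intro A B C hA hB
    have e1 := h.metric A B x hA hB (C x)
    have e2 := h'.metric A B x hA hB (C x)
    rw [g.symm x _ (B x)] at e1 e2
    simp only [map_sub]
    linarith
  have sy : ∀ {A B : Π x : M, TangentSpace I x}, MDiffAt (T% A) x → MDiffAt (T% B) x →
      cov A x (B x) - cov' A x (B x) = cov B x (A x) - cov' B x (A x) := by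
    intro A B hA hB
    have e1 := (h.torsionFree B A x hB hA).trans (h'.torsionFree B A x hB hA).symm
    have := sub_eq_sub_iff_sub_eq_sub.1 e1
    exact this
  ext u
  rw [← sub_eq_zero]
  refine g.nondegenerate x _ fun w ↦ ?_
  have k1 := key (C := extend E u) hY (hD w)
  have k2 := key (C := Y) (hD w) (hD u)
  have k3 := key (C := extend E w) (hD u) hY
  rw [← sy (hD u) (hD w)] at k1
  rw [← sy hY (hD u), ← sy hY (hD w)] at k2
  rw [g.symm]
  simp only [extend_apply_self] at *
  linarith

/-- Two metrics are affinely equivalent if their Levi-Civita connections coincide: one and the same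
connection is a Levi-Civita connection of both. -/
def PseudoRiemannianMetric.AffinelyEquivalent (g g' : PseudoRiemannianMetric I M) : Prop :=
  ∃ cov : CovariantDerivative I E (TangentSpace I : M → Type _),
    g.IsLeviCivita cov ∧ g'.IsLeviCivita cov

variable (I) in
/-- The velocity vector of a curve. -/
def curveVelocity (γ : ℝ → M) (t : ℝ) : TangentSpace I (γ t) :=
  mfderiv 𝓘(ℝ, ℝ) I γ t (1 : ℝ)

/-- The covariant derivative at time `t` of a vector field `V` along the curve `γ`. If
`V s = ∑ᵢ vⁱ(s) ∂ᵢ` in the coordinate frame `(∂ᵢ)` of the preferred chart at `γ t`, it equals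
`∑ᵢ ((vⁱ)'(t) ∂ᵢ + vⁱ(t) ∇_{γ'(t)} ∂ᵢ)`: the first summand below is the first part, and
`FiberBundle.extend E (V t)` is the field `∑ᵢ vⁱ(t) ∂ᵢ` near `γ t`, with constant coefficients. -/
def covDerivAlong (cov : CovariantDerivative I E (TangentSpace I : M → Type _))
    (γ : ℝ → M) (V : Π s : ℝ, TangentSpace I (γ s)) (t : ℝ) : TangentSpace I (γ t) :=
  (trivializationAt E (TangentSpace I : M → Type _) (γ t)).symm (γ t)
      (deriv (fun s ↦ (trivializationAt E (TangentSpace I : M → Type _) (γ t)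
        (Bundle.TotalSpace.mk' E (γ s) (V s))).2) t)
    + cov (FiberBundle.extend E (V t)) (γ t) (curveVelocity I γ t)

/-- `γ` is an (affinely parametrized) geodesic of `g` on the open set `J` of times: it is `C²` there
and satisfies `∇_{γ'} γ' = 0` for the Levi-Civita connection. -/
def PseudoRiemannianMetric.IsGeodesicOn (g : PseudoRiemannianMetric I M)
    (γ : ℝ → M) (J : Set ℝ) : Prop :=
  ContMDiffOn 𝓘(ℝ, ℝ) I 2 γ J ∧
    ∃ cov : CovariantDerivative I E (TangentSpace I : M → Type _), g.IsLeviCivita cov ∧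
      ∀ t ∈ J, covDerivAlong cov γ (curveVelocity I γ) t = 0

/-- `γ` is on the open interval `J` a reparametrized geodesic of `g`: `γ = η ∘ τ` for a regular
change of parameter `τ` from `J` to the interval `τ '' J` and a geodesic `η` on that interval. -/
def PseudoRiemannianMetric.IsReparametrizedGeodesicOn (g : PseudoRiemannianMetric I M)
    (γ : ℝ → M) (J : Set ℝ) : Prop :=
  ∃ (τ : ℝ → ℝ) (η : ℝ → M), ContDiffOn ℝ 2 τ J ∧ (∀ t ∈ J, deriv τ t ≠ 0) ∧
    g.IsGeodesicOn η (τ '' J) ∧ ∀ t ∈ J, γ t = η (τ t)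

/-- `g'` is geodesically equivalent to `g`: every geodesic of `g`, on any open interval, is a
reparametrized geodesic of `g'`. -/
def PseudoRiemannianMetric.GeodesicallyEquivalent (g g' : PseudoRiemannianMetric I M) : Prop :=
  ∀ (γ : ℝ → M) (J : Set ℝ), IsOpen J → J.OrdConnected →
    g.IsGeodesicOn γ J → g'.IsReparametrizedGeodesicOn γ J

end PseudoRiemannian

/-- A metric on a Lie group is left-invariant if all left translations are isometries. -/
def PseudoRiemannianMetric.IsLeftInvariant {E : Type*} [NormedAddCommGroup E] [NormedSpace ℝ E]
    {H : Type*} [TopologicalSpace H] {I : ModelWithCorners ℝ E H}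
    {G : Type*} [TopologicalSpace G] [ChartedSpace H G] [IsManifold I ∞ G] [Group G]
    (g : PseudoRiemannianMetric I G) : Prop :=
  ∀ (a x : G) (v w : TangentSpace I x),
    g.form (a * x) (mfderiv I I (fun y ↦ a * y) x v) (mfderiv I I (fun y ↦ a * y) x w)
      = g.form x v w

end

noncomputable section

section Algebra

open Module

variable {V : Type*} [AddCommGroup V] [Module ℝ V] [FiniteDimensional ℝ V]

/-- An endomorphism that is skew-adjoint for a nondegenerate bilinear form has trace zero. -/
theorem LinearMap.trace_eq_zero_of_skew (β : LinearMap.BilinForm ℝ V) (hβ : β.Nondegenerate)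
    (A : V →ₗ[ℝ] V) (hA : ∀ v w, β (A v) w + β v (A w) = 0) : LinearMap.trace ℝ V A = 0 := by
  have h : (β.toDual hβ).conj A = -(Module.Dual.transpose A) := by
    ext f w
    obtain ⟨v, rfl⟩ := (β.toDual hβ).surjective f
    have := hA v w
    simp [LinearEquiv.conj_apply, LinearMap.BilinForm.toDual_def, Module.Dual.transpose_apply]
    linarith
  have h1 := LinearMap.trace_conj' A (β.toDual hβ)
  rw [h, ← neg_one_smul ℝ (Module.Dual.transpose A), map_smul, LinearMap.trace_transpose',
    smul_eq_mul] at h1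
  linarith

/-- The algebraic Koszul formula: a nondegenerate symmetric form and a skew-symmetric bracket
determine a torsion-free product whose left multiplications are skew-adjoint. -/
theorem LinearMap.BilinForm.exists_koszul (β : LinearMap.BilinForm ℝ V) (hβ : β.Nondegenerate)
    (hs : ∀ v w, β v w = β w v) (c : V →ₗ[ℝ] V →ₗ[ℝ] V) (hc : ∀ v w, c v w = -c w v) :
    ∃ B : V →ₗ[ℝ] V →ₗ[ℝ] V, (∀ u v, B u v - B v u = c u v) ∧
      ∀ u v w, β (B u v) w + β v (B u w) = 0 := by
  let K : V →ₗ[ℝ] V →ₗ[ℝ] Dual ℝ V := LinearMap.mk₂ ℝ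
    (fun u v ↦ (1 / 2 : ℝ) • (β (c u v) - (β u) ∘ₗ (c v) - (β v) ∘ₗ (c u)))
    (fun u u' v ↦ by ext w; simp; ring) (fun a u v ↦ by ext w; simp; ring)
    (fun u v v' ↦ by ext w; simp; ring) (fun a u v ↦ by ext w; simp; ring)
  have hK (u v w) : β ((β.toDual hβ).symm (K u v)) w
      = (1 / 2 : ℝ) * (β (c u v) w - β u (c v w) - β v (c u w)) := by
    rw [← LinearMap.BilinForm.toDual_def hβ, LinearEquiv.apply_symm_apply]
    simp [K]
  refine ⟨K.compr₂ (β.toDual hβ).symm.toLinearMap, fun u v ↦ ?_, fun u v w ↦ ?_⟩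
  · rw [← sub_eq_zero]
    refine (β.toDual hβ).injective ?_
    ext w
    simp only [LinearMap.BilinForm.toDual_def, LinearMap.compr₂_apply, LinearEquiv.coe_coe,
      map_sub, LinearMap.sub_apply, hK, map_zero, LinearMap.zero_apply]
    rw [hc v u]
    simp only [map_neg, LinearMap.neg_apply]
    ring
  · rw [hs v]
    simp only [LinearMap.compr₂_apply, LinearEquiv.coe_coe, hK]
    rw [hc w v, hs (c u v) w, hs (c u w) v]
    simp only [map_neg]
    ring

/-- A symmetric product with `D v v ∈ ℝ v` all of whose left multiplications are trace-free
vanishes. -/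
theorem LinearMap.eq_zero_of_diagonal_parallel (D : V →ₗ[ℝ] V →ₗ[ℝ] V)
    (hs : ∀ v w, D v w = D w v) (hD : ∀ v, ∃ r : ℝ, D v v = r • v)
    (ht : ∀ v, LinearMap.trace ℝ V (D v) = 0) : D = 0 := by
  choose r hr using hD
  have hpar (v w : V) (h : LinearIndependent ℝ ![v, w]) :
      (2 : ℝ) • D v w = r w • v + r v • w := by
    have h1 := hr (v + w)
    have h2 := hr (v - w)
    simp only [map_add, map_sub, LinearMap.add_apply, LinearMap.sub_apply, hs w v, hr v, hr w]
      at h1 h2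
    rw [LinearIndependent.pair_iff] at h
    obtain ⟨h3, h4⟩ := h (2 * r v - r (v + w) - r (v - w)) (2 * r w - r (v + w) + r (v - w)) (by
      rw [← sub_eq_zero] at h1 h2
      rw [← add_zero (0 : V), ← congrArg₂ (· + ·) h1 h2]
      module)
    have e : (2 : ℝ) • D v w = (r (v + w) - r v) • v + (r (v + w) - r w) • w := by
      rw [← sub_eq_zero] at h1 ⊢
      rw [← h1]
      module
    rw [e]
    congr 2 <;> linarith
  have hdiag (v : V) : D v v = 0 := by
    by_cases hv : v = 0
    · simp [hv]
    obtain ⟨f, hf⟩ := Module.Projective.exists_dual_eq_one ℝ hv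
    set A : V →ₗ[ℝ] V := D v - (r v / 2) • LinearMap.id with hA
    have hAv : A v = (r v / 2) • v := by
      simp only [hA, LinearMap.sub_apply, LinearMap.smul_apply, LinearMap.id_apply, hr]
      module
    have hrank : A = (f ∘ₗ A).smulRight v := by
      ext w
      suffices ∃ s : ℝ, A w = s • v by
        obtain ⟨s, hs⟩ := this
        simp [hs, hf]
      by_cases h : LinearIndependent ℝ ![v, w]
      · refine ⟨r w / 2, ?_⟩
        have h2 : D v w = (1 / 2 : ℝ) • ((2 : ℝ) • D v w) := by module
        simp only [hA, LinearMap.sub_apply, LinearMap.smul_apply, LinearMap.id_apply]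
        rw [h2, hpar v w h]
        module
      · rw [LinearIndependent.pair_iff' hv] at h
        push Not at h
        obtain ⟨s, rfl⟩ := h
        exact ⟨s * (r v / 2), by rw [map_smul, hAv, smul_smul]⟩
    have h1 : LinearMap.trace ℝ V A = r v / 2 := by
      rw [hrank, LinearMap.trace_smulRight]
      simp [hAv, hf]
    have h2 : LinearMap.trace ℝ V A = -(r v / 2) * finrank ℝ V := by
      rw [hA, map_sub, ht, map_smul, LinearMap.trace_id, smul_eq_mul]
      ring
    have h3 : r v * (finrank ℝ V + 1) = 0 := by linarith
    have h4 : r v = 0 := by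
      rcases mul_eq_zero.1 h3 with h | h
      · exact h
      · exact absurd h (by positivity)
    rw [hr, h4, zero_smul]
  ext v w
  have := hdiag (v + w)
  simp only [map_add, LinearMap.add_apply, hdiag, hs w v] at this
  have h2 : (2 : ℝ) • D v w = 0 := by rw [two_smul]; simpa using this
  simpa using h2

end Algebra

end

noncomputable section

open Bundle

variable {E : Type*} [NormedAddCommGroup E] [NormedSpace ℝ E]
    {H : Type*} [TopologicalSpace H] {I : ModelWithCorners ℝ E H}
    {G : Type*} [TopologicalSpace G] [ChartedSpace H G] [Group G]

variable (I) in
/-- Left translation of vectors from the tangent space at the identity, identified with `E`. -/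
def leftTranslate (x : G) : E →L[ℝ] TangentSpace I x :=
  (mfderiv I I (fun y : G ↦ x * y) 1 : TangentSpace I (1 : G) →L[ℝ] TangentSpace I (x * 1))

variable (I) in
/-- The Maurer-Cartan form, with values in the tangent space at the identity, identified
with `E`. -/
def maurerCartan (x : G) : TangentSpace I x →L[ℝ] E :=
  (mfderiv I I (fun y : G ↦ x⁻¹ * y) x : TangentSpace I x →L[ℝ] TangentSpace I (x⁻¹ * x))

theorem TangentBundle.trivializationAt_apply_self {M : Type*} [TopologicalSpace M]
    [ChartedSpace H M] [IsManifold I 1 M] (x : M) (v : TangentSpace I x) :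
    (trivializationAt E (TangentSpace I : M → Type _) x ⟨x, v⟩).2 = v :=
  tangentCoordChange_self (mem_extChartAt_source x)

variable [LieGroup I ∞ G]

instance : LieGroup I (minSmoothness ℝ 3) G :=
  LieGroup.of_le (n := ∞) (by
    simp only [minSmoothness_of_isRCLikeNormedField]
    exact WithTop.coe_le_coe.2 le_top)

theorem maurerCartan_leftTranslate (x : G) (v : E) :
    maurerCartan I x (leftTranslate I x v) = v := by
  have h : mfderiv I I ((fun y : G ↦ x⁻¹ * y) ∘ (fun y : G ↦ x * y)) 1
      = ContinuousLinearMap.id ℝ (TangentSpace I (1 : G)) := by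
    have : (fun y : G ↦ x⁻¹ * y) ∘ (fun y : G ↦ x * y) = id := by ext; simp
    rw [this]
    exact mfderiv_id
  have h' := mfderiv_comp_of_eq (I := I) (I' := I) (I'' := I) (x := (1 : G)) (y := x)
    (g := fun y : G ↦ x⁻¹ * y) (f := fun y : G ↦ x * y)
    (contMDiff_mul_left (n := ∞)|>.mdifferentiableAt (by simp))
    (contMDiff_mul_left (n := ∞)|>.mdifferentiableAt (by simp)) (mul_one x)
  rw [h] at h'
  have e := congrArg (fun z : G ↦ (show E →L[ℝ] E from mfderiv I I (fun y : G ↦ x⁻¹ * y) z))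
    (mul_one x)
  exact (DFunLike.congr_fun e (leftTranslate I x v)).symm.trans (DFunLike.congr_fun h' v).symm

theorem leftTranslate_maurerCartan (x : G) (v : TangentSpace I x) :
    leftTranslate I x (maurerCartan I x v) = v := by
  have h : mfderiv I I ((fun y : G ↦ x * y) ∘ (fun y : G ↦ x⁻¹ * y)) x
      = ContinuousLinearMap.id ℝ (TangentSpace I x) := by
    have : (fun y : G ↦ x * y) ∘ (fun y : G ↦ x⁻¹ * y) = id := by ext; simp
    rw [this]
    exact mfderiv_id
  have h' := mfderiv_comp_of_eq (I := I) (I' := I) (I'' := I) (x := x) (y := 1)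
    (g := fun y : G ↦ x * y) (f := fun y : G ↦ x⁻¹ * y)
    (contMDiff_mul_left (n := ∞)|>.mdifferentiableAt (by simp))
    (contMDiff_mul_left (n := ∞)|>.mdifferentiableAt (by simp)) (inv_mul_cancel x)
  rw [h] at h'
  have e := congrArg (fun z : G ↦ (show E →L[ℝ] E from mfderiv I I (fun y : G ↦ x * y) z))
    (inv_mul_cancel x)
  exact (DFunLike.congr_fun e (maurerCartan I x v)).symm.trans (DFunLike.congr_fun h' v).symm

theorem contMDiff_leftTranslate :
    ContMDiff (I.prod 𝓘(ℝ, E)) I.tangent 2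
      (fun p : G × E ↦ (⟨p.1, leftTranslate I p.1 p.2⟩ : TangentBundle I G)) := by
  let F₁ : G × E → TangentBundle I G × TangentBundle I G :=
    fun p ↦ (TotalSpace.mk' E p.1 0, TotalSpace.mk' E 1 p.2)
  have S₁ : ContMDiff (I.prod 𝓘(ℝ, E)) (I.tangent.prod I.tangent) 2 F₁ := by
    refine ContMDiff.prodMk ?_ ?_
    · exact (contMDiff_zeroSection ℝ (TangentSpace I : G → Type _)).comp contMDiff_fst
    · intro p
      refine contMDiffAt_totalSpace.2 ⟨contMDiffAt_const, ?_⟩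
      simp only [TangentBundle.trivializationAt_apply, mfld_simps]
      exact (ContinuousLinearMap.contMDiff _).comp contMDiff_snd p
  have S₂ : ContMDiff (I.tangent.prod I.tangent) (I.prod I).tangent 2
    (equivTangentBundleProd I G I G).symm := contMDiff_equivTangentBundleProd_symm
  have S₃ : ContMDiff (I.prod I).tangent I.tangent 2
      (tangentMap (I.prod I) I (fun p : G × G ↦ p.1 * p.2)) :=
    ContMDiff.contMDiff_tangentMap (n := ∞) (contMDiff_mul I ∞) (WithTop.coe_le_coe.2 le_top)
  have S := (S₃.comp S₂).comp S₁
  convert! S with p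
  · simp [F₁]
  · simp only [Function.comp_apply, tangentMap, F₁]
    rw [mfderiv_prod_eq_add_apply ((contMDiff_mul I ∞).mdifferentiable (by simp) _)]
    exact ((congrArg (· + _) (map_zero _)).trans (zero_add _)).symm

theorem contMDiff_maurerCartan :
    ContMDiff I.tangent 𝓘(ℝ, E) 2
      (fun p : TangentBundle I G ↦ maurerCartan I p.1 p.2) := by
  let F₁ : TangentBundle I G → TangentBundle I G × TangentBundle I G :=
    fun p ↦ (TotalSpace.mk' E p.1⁻¹ 0, p)
  have S₁ : ContMDiff I.tangent (I.tangent.prod I.tangent) 2 F₁ := by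
    refine ContMDiff.prodMk ?_ contMDiff_id
    exact ((contMDiff_zeroSection ℝ (TangentSpace I : G → Type _)).comp
      ((contMDiff_inv I ∞).of_le (WithTop.coe_le_coe.2 le_top))).comp
        (contMDiff_proj (TangentSpace I : G → Type _))
  have S₂ : ContMDiff (I.tangent.prod I.tangent) (I.prod I).tangent 2
    (equivTangentBundleProd I G I G).symm := contMDiff_equivTangentBundleProd_symm
  have S₃ : ContMDiff (I.prod I).tangent I.tangent 2
      (tangentMap (I.prod I) I (fun p : G × G ↦ p.1 * p.2)) :=
    ContMDiff.contMDiff_tangentMap (n := ∞) (contMDiff_mul I ∞) (WithTop.coe_le_coe.2 le_top)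
  have S := (S₃.comp S₂).comp S₁
  have S' : ContMDiff I.tangent I.tangent 2
      (fun p : TangentBundle I G ↦ (⟨1, maurerCartan I p.1 p.2⟩ : TangentBundle I G)) := by
    refine S.congr fun p ↦ TotalSpace.ext ?_ (heq_of_eq ?_)
    · simp [F₁]
    · simp only [Function.comp_apply, tangentMap, F₁]
      rw [mfderiv_prod_eq_add_apply ((contMDiff_mul I ∞).mdifferentiable (by simp) _)]
      exact ((congrArg (· + _) (map_zero _)).trans (zero_add _)).symm
  intro p
  have := (contMDiffAt_totalSpace.1 (S' p)).2
  exact this.congr_of_eventuallyEq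
    (.of_forall fun q ↦ (TangentBundle.trivializationAt_apply_self 1 (maurerCartan I q.1 q.2)).symm)

end

noncomputable section

open Bundle

variable {E : Type*} [NormedAddCommGroup E] [NormedSpace ℝ E]
    {H : Type*} [TopologicalSpace H] {I : ModelWithCorners ℝ E H}
    {G : Type*} [TopologicalSpace G] [ChartedSpace H G] [Group G] [LieGroup I ∞ G]

theorem mvfderiv_bilinear {M : Type*} [TopologicalSpace M] [ChartedSpace H M]
    {F₁ F₂ F₃ : Type*} [NormedAddCommGroup F₁] [NormedSpace ℝ F₁] [NormedAddCommGroup F₂]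
    [NormedSpace ℝ F₂] [NormedAddCommGroup F₃] [NormedSpace ℝ F₃] (b : F₁ →L[ℝ] F₂ →L[ℝ] F₃)
    {f : M → F₁} {h : M → F₂} {x : M} (hf : MDifferentiableAt I 𝓘(ℝ, F₁) f x)
    (hh : MDifferentiableAt I 𝓘(ℝ, F₂) h x) (u : TangentSpace I x) :
    mvfderiv I (fun y ↦ b (f y) (h y)) x u = b (f x) (mvfderiv I h x u)
      + b (mvfderiv I f x u) (h x) := by
  have h1 := b.hasFDerivWithinAt_of_bilinear hf.hasMFDerivAt.2 hh.hasMFDerivAt.2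
  simp only [writtenInExtChartAt, extChartAt_model_space_eq_id, PartialEquiv.refl_coe,
    Function.comp_apply, id_eq, extChartAt_to_inv] at h1
  have h2 : HasMFDerivAt I 𝓘(ℝ, F₃) (fun y ↦ b (f y) (h y)) x _ :=
    ⟨b.isBoundedBilinearMap.continuous.continuousAt.comp
      (hf.continuousAt.prodMk hh.continuousAt), h1⟩
  exact DFunLike.congr_fun h2.mfderiv u

theorem MDifferentiableAt.maurerCartan {E' : Type*} [NormedAddCommGroup E'] [NormedSpace ℝ E']
    {H' : Type*} [TopologicalSpace H'] {I' : ModelWithCorners ℝ E' H'}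
    {M : Type*} [TopologicalSpace M] [ChartedSpace H' M] {γ : M → G}
    {V : Π y : M, TangentSpace I (γ y)} {x : M}
    (h : MDifferentiableAt I' I.tangent (fun y ↦ (⟨γ y, V y⟩ : TangentBundle I G)) x) :
    MDifferentiableAt I' 𝓘(ℝ, E) (fun y ↦ maurerCartan I (γ y) (V y)) x :=
  (contMDiff_maurerCartan.mdifferentiableAt (by simp)).comp x h

variable (I G) in
/-- The bracket of the Lie algebra, as a bilinear map on the model space. -/
def lieBracketBilin [CompleteSpace E] : E →ₗ[ℝ] E →ₗ[ℝ] E :=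
  LinearMap.mk₂ ℝ (fun u v : E ↦ @Bracket.bracket (GroupLieAlgebra I G) (GroupLieAlgebra I G) _ u v)
    (@add_lie (GroupLieAlgebra I G) (GroupLieAlgebra I G) _ _ _)
    (@smul_lie ℝ (GroupLieAlgebra I G) (GroupLieAlgebra I G) _ _ _ _ _ _ _)
    (@lie_add (GroupLieAlgebra I G) (GroupLieAlgebra I G) _ _ _)
    (@lie_smul ℝ (GroupLieAlgebra I G) (GroupLieAlgebra I G) _ _ _ _ _ _ _)

theorem lieBracketBilin_skew [CompleteSpace E] (u v : E) :
    lieBracketBilin I G u v = -lieBracketBilin I G v u :=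
  (lie_skew (L := GroupLieAlgebra I G) u v).symm

theorem mlieBracket_leftTranslate [CompleteSpace E] (u v : E) (x : G) :
    VectorField.mlieBracket I (fun y : G ↦ leftTranslate I y u) (fun y ↦ leftTranslate I y v) x
      = leftTranslate I x (lieBracketBilin I G u v) :=
  (congrFun (mulInvariantVector_mlieBracket (I := I) (G := G) u v) x).symm

theorem mdifferentiable_leftTranslate (u : E) :
    MDifferentiable I I.tangent (fun y : G ↦ (⟨y, leftTranslate I y u⟩ : TangentBundle I G)) :=
  mdifferentiable_mulInvariantVectorField (I := I) (G := G) u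

/-- The value of a metric at the identity, as a bilinear form on the model space. -/
def PseudoRiemannianMetric.formOne (g : PseudoRiemannianMetric I G) :
    LinearMap.BilinForm ℝ E :=
  LinearMap.mk₂ ℝ (fun v w : E ↦ g.form 1 v w)
    (fun u v w ↦ congrArg (· w) (map_add (g.form 1) u v))
    (fun c v w ↦ congrArg (· w) (map_smul (g.form 1) c v))
    (fun u v w ↦ map_add (g.form 1 u) v w) (fun c v w ↦ map_smul (g.form 1 v) c w)

theorem PseudoRiemannianMetric.IsLeftInvariant.form_apply {g : PseudoRiemannianMetric I G}
    (hg : g.IsLeftInvariant) (x : G) (v w : TangentSpace I x) :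
    g.form x v w = g.formOne (maurerCartan I x v) (maurerCartan I x w) := by
  have h := hg x 1 (maurerCartan I x v) (maurerCartan I x w)
  have e := congrArg (fun z : G ↦ (show E →L[ℝ] E →L[ℝ] ℝ from g.form z)) (mul_one x)
  refine Eq.trans ?_ h
  conv_lhs => rw [← leftTranslate_maurerCartan x v, ← leftTranslate_maurerCartan x w]
  exact (DFunLike.congr_fun (DFunLike.congr_fun e _) _).symm

variable [FiniteDimensional ℝ E]

variable (I G) in
/-- The left-invariant connection on a Lie group determined by a product on the Lie algebra. -/
def leftInvariantConnection (B : E →ₗ[ℝ] E →ₗ[ℝ] E) :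
    CovariantDerivative I E (TangentSpace I : G → Type _) where
  toFun Y x := leftTranslate I x ∘L (mvfderiv I (fun y ↦ maurerCartan I y (Y y)) x
    + (LinearMap.toContinuousLinearMap (B.flip (maurerCartan I x (Y x)))) ∘L maurerCartan I x)
  isCovariantDerivativeOnUniv :=
    { add {Y Z x} hY hZ _ := by
        have := mvfderiv_fun_add hY.maurerCartan hZ.maurerCartan
        ext u
        simp only [Pi.add_apply, map_add, this]
        simp
        abel
      leibniz {Y f x} hY hf _ := by
        have := mvfderiv_fun_smul hf hY.maurerCartan
        ext u
        simp only [Pi.smul_apply', map_smul, this]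
        simp [leftTranslate_maurerCartan]
        module }

theorem leftInvariantConnection_apply (B : E →ₗ[ℝ] E →ₗ[ℝ] E) (Y : Π x : G, TangentSpace I x)
    (x : G) (u : TangentSpace I x) :
    leftInvariantConnection I G B Y x u = leftTranslate I x
      (mvfderiv I (fun y ↦ maurerCartan I y (Y y)) x u
        + B (maurerCartan I x u) (maurerCartan I x (Y x))) := rfl

theorem leftInvariantConnection_torsionFree (B : E →ₗ[ℝ] E →ₗ[ℝ] E)
    (hB : ∀ u v, B u v - B v u = lieBracketBilin I G u v) :
    (leftInvariantConnection I G B).torsion = 0 := by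
  ext x u v
  have h := (leftInvariantConnection I G B).torsion_apply
    (mdifferentiable_leftTranslate (maurerCartan I x u) x)
    (mdifferentiable_leftTranslate (maurerCartan I x v) x)
  simp only [leftTranslate_maurerCartan, leftInvariantConnection_apply,
    mlieBracket_leftTranslate, maurerCartan_leftTranslate] at h
  rw [h, ← hB, mvfderiv_const, mvfderiv_const]
  simp


theorem PseudoRiemannianMetric.formOne_nondegenerate (g : PseudoRiemannianMetric I G) :
    g.formOne.Nondegenerate := by
  rw [LinearMap.BilinForm.nondegenerate_iff_ker_eq_bot]
  refine (LinearMap.ker_eq_bot').2 fun v hv ↦ g.nondegenerate 1 v fun w ↦ ?_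
  exact DFunLike.congr_fun hv w

theorem PseudoRiemannianMetric.IsLeftInvariant.isLeviCivita {g : PseudoRiemannianMetric I G}
    (hg : g.IsLeftInvariant) {B : E →ₗ[ℝ] E →ₗ[ℝ] E}
    (hB : ∀ u v, B u v - B v u = lieBracketBilin I G u v)
    (hB' : ∀ u v w, g.formOne (B u v) w + g.formOne v (B u w) = 0) :
    g.IsLeviCivita (leftInvariantConnection I G B) where
  torsionFree X Y x hX hY :=
    (CovariantDerivative.torsion_eq_zero_iff _).1 (leftInvariantConnection_torsionFree B hB) hX hY
  metric Y Z x hY hZ u := by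
    simp only [hg.form_apply, leftInvariantConnection_apply, maurerCartan_leftTranslate]
    let b : E →L[ℝ] E →L[ℝ] ℝ := g.form 1
    have h3 := mvfderiv_bilinear b hY.maurerCartan hZ.maurerCartan u
    refine Eq.trans h3 ?_
    have h4 := hB' (maurerCartan I x u) (maurerCartan I x (Y x)) (maurerCartan I x (Z x))
    simp only [map_add, LinearMap.add_apply]
    refine Eq.trans (b := g.formOne (maurerCartan I x (Y x))
        (mvfderiv I (fun y ↦ maurerCartan I y (Z y)) x u)
      + g.formOne (mvfderiv I (fun y ↦ maurerCartan I y (Y y)) x u) (maurerCartan I x (Z x)))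
      rfl ?_
    linarith

theorem PseudoRiemannianMetric.IsLeftInvariant.exists_isLeviCivita
    {g : PseudoRiemannianMetric I G} (hg : g.IsLeftInvariant) :
    ∃ B : E →ₗ[ℝ] E →ₗ[ℝ] E, (∀ u v, B u v - B v u = lieBracketBilin I G u v) ∧
      (∀ u, LinearMap.trace ℝ E (B u) = 0) ∧ g.IsLeviCivita (leftInvariantConnection I G B) := by
  obtain ⟨B, h1, h2⟩ := g.formOne.exists_koszul g.formOne_nondegenerate (fun v w ↦ g.symm 1 v w)
    (lieBracketBilin I G) lieBracketBilin_skew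
  exact ⟨B, h1, fun u ↦ LinearMap.trace_eq_zero_of_skew _ g.formOne_nondegenerate _ (h2 u),
    hg.isLeviCivita h1 h2⟩

end

noncomputable section

open Bundle

variable {E : Type*} [NormedAddCommGroup E] [NormedSpace ℝ E]
    {H : Type*} [TopologicalSpace H] {I : ModelWithCorners ℝ E H}
    {G : Type*} [TopologicalSpace G] [ChartedSpace H G] [Group G] [LieGroup I ∞ G]

/-- The covariant derivative along a curve, in the left trivialization of the tangent bundle. -/
theorem maurerCartan_covDerivAlong [FiniteDimensional ℝ E] (B : E →ₗ[ℝ] E →ₗ[ℝ] E) {γ : ℝ → G}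
    {V : Π s : ℝ, TangentSpace I (γ s)} {t : ℝ}
    (h : MDifferentiableAt 𝓘(ℝ, ℝ) I.tangent (fun s ↦ (⟨γ s, V s⟩ : TangentBundle I G)) t) :
    maurerCartan I (γ t) (covDerivAlong (leftInvariantConnection I G B) γ V t)
      = deriv (fun s ↦ maurerCartan I (γ s) (V s)) t
        + B (maurerCartan I (γ t) (curveVelocity I γ t)) (maurerCartan I (γ t) (V t)) := by
  set e := trivializationAt E (TangentSpace I : G → Type _) (γ t) with he
  have hx : γ t ∈ e.baseSet := FiberBundle.mem_baseSet_trivializationAt' (γ t)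
  obtain ⟨hγ, hc⟩ := (mdifferentiableAt_totalSpace (F := E) (IB := I) _).1 h
  simp only at hγ hc
  set c : ℝ → E := fun s ↦ (e ⟨γ s, V s⟩).2 with hcdef
  change MDifferentiableAt 𝓘(ℝ, ℝ) 𝓘(ℝ, E) c t at hc
  let Φ : G × E → E := fun p ↦ maurerCartan I p.1 (e.symm p.1 p.2)
  have hΦ : MDifferentiableAt (I.prod 𝓘(ℝ, E)) 𝓘(ℝ, E) Φ (γ t, c t) := by
    have h1 : MDifferentiableAt (I.prod 𝓘(ℝ, E)) I.tangent
        (fun p : G × E ↦ (⟨p.1, e.symm p.1 p.2⟩ : TangentBundle I G)) (γ t, c t) := by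
      have h2 := (e.contMDiffOn_symm (n := 1) (IB := I)).contMDiffAt
        (x := (γ t, c t)) (e.open_target.mem_nhds (e.mem_target.2 hx))
      refine (h2.mdifferentiableAt (by simp)).congr_of_eventuallyEq ?_
      filter_upwards [e.open_target.mem_nhds (e.mem_target.2 hx : (γ t, c t) ∈ e.target)] with p hp
      exact e.mk_symm (e.mem_target.1 hp) p.2
    exact h1.maurerCartan
  have heq : (fun s ↦ maurerCartan I (γ s) (V s)) =ᶠ[𝓝 t] fun s ↦ Φ (γ s, c s) := by
    filter_upwards [hγ.continuousAt.preimage_mem_nhds (e.open_baseSet.mem_nhds hx)] with s hs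
    simp only [Φ, c]
    rw [e.symm_apply_apply_mk hs]
  have hcomp := HasMFDerivAt.comp t hΦ.hasMFDerivAt (hγ.hasMFDerivAt.prodMk hc.hasMFDerivAt)
  have hd : deriv (fun s ↦ maurerCartan I (γ s) (V s)) t
      = mfderiv (I.prod 𝓘(ℝ, E)) 𝓘(ℝ, E) Φ (γ t, c t) (curveVelocity I γ t, deriv c t) := by
    rw [heq.deriv_eq, ← fderiv_apply_one_eq_deriv, ← fderiv_apply_one_eq_deriv (f := c),
      ← mfderiv_eq_fderiv, ← mfderiv_eq_fderiv]
    exact DFunLike.congr_fun hcomp.mfderiv (1 : ℝ)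
  replace hd := hd.trans (mfderiv_prod_eq_add_apply hΦ)
  have h2 : mfderiv 𝓘(ℝ, E) 𝓘(ℝ, E) (fun w ↦ Φ (γ t, w)) (c t) (deriv c t)
      = maurerCartan I (γ t) (e.symm (γ t) (deriv c t)) := by
    have : (fun w ↦ Φ (γ t, w)) = (maurerCartan I (γ t)) ∘L (e.symmL ℝ (γ t)) := by
      ext w
      simp [Φ, e.symmL_apply hx]
    rw [mfderiv_eq_fderiv, this, ContinuousLinearMap.fderiv]
    exact congrArg _ (e.symmL_apply hx _)
  have hsum : deriv (fun s ↦ maurerCartan I (γ s) (V s)) t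
      = mvfderiv I (fun y ↦ maurerCartan I y (FiberBundle.extend E (V t) y)) (γ t)
        (curveVelocity I γ t) + maurerCartan I (γ t) (e.symm (γ t) (deriv c t)) :=
    hd.trans (congrArg (fun w : E ↦ (mvfderiv I (fun y ↦ maurerCartan I y
      (FiberBundle.extend E (V t) y)) (γ t) (curveVelocity I γ t) : E) + w) h2)
  rw [hsum, covDerivAlong, map_add, leftInvariantConnection_apply, maurerCartan_leftTranslate,
    FiberBundle.extend_apply_self]
  abel

end

noncomputable section

open Bundle

/-- Integral curves of a `C^n` vector field exist and are `C^n`. -/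
theorem ContDiffOn.exists_integralCurve {F : Type*} [NormedAddCommGroup F] [NormedSpace ℝ F]
    [CompleteSpace F] {n : ℕ∞} (hn : 1 ≤ n) {f : F → F} {U : Set F} (hU : IsOpen U)
    (hf : ContDiffOn ℝ n f U) {z : F} (hz : z ∈ U) :
    ∃ (α : ℝ → F) (ε : ℝ), 0 < ε ∧ α 0 = z ∧ ContDiffOn ℝ n α (Set.Ioo (-ε) ε) ∧
      ∀ t ∈ Set.Ioo (-ε) ε, α t ∈ U ∧ HasDerivAt α (f (α t)) t := by
  obtain ⟨α, h0, ε, hε, hα⟩ :=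
    ((hf.contDiffAt (hU.mem_nhds hz)).of_le (mod_cast hn)
      ).exists_forall_mem_closedBall_exists_eq_forall_mem_Ioo_hasDerivAt₀ 0
  simp only [zero_sub, zero_add] at hα
  have hc : ContinuousAt α 0 := (hα 0 ⟨by linarith, hε⟩).continuousAt
  obtain ⟨δ, hδ, hball⟩ := Metric.mem_nhds_iff.1
    (hc.preimage_mem_nhds (hU.mem_nhds (by rwa [h0])))
  have hlt : min ε δ / 2 < min ε δ := half_lt_self (lt_min hε hδ)
  have hpos : 0 < min ε δ / 2 := half_pos (lt_min hε hδ)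
  have hsub : ∀ t ∈ Set.Icc (-(min ε δ / 2)) (min ε δ / 2), α t ∈ U ∧ HasDerivAt α (f (α t)) t := by
    intro t ht
    have h1 := min_le_left ε δ
    have h2 := min_le_right ε δ
    refine ⟨hball ?_, hα t ⟨by linarith [ht.1], by linarith [ht.2]⟩⟩
    rw [Metric.mem_ball, Real.dist_eq, sub_zero, abs_lt]
    exact ⟨by linarith [ht.1], by linarith [ht.2]⟩
  refine ⟨α, min ε δ / 2, hpos, h0, ?_, fun t ht ↦ hsub t (Set.Ioo_subset_Icc_self ht)⟩
  refine ContDiffOn.mono (ODE.contDiffOn_enat_Icc_of_hasDerivWithinAt (f := fun _ ↦ f) (u := U)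
    ?_ (fun t ht ↦ (hsub t ht).2.hasDerivWithinAt) (fun t ht ↦ (hsub t ht).1))
    Set.Ioo_subset_Icc_self
  exact hf.comp contDiffOn_snd fun p hp ↦ hp.2

variable {E : Type*} [NormedAddCommGroup E] [NormedSpace ℝ E]
    {H : Type*} [TopologicalSpace H] {I : ModelWithCorners ℝ E H} [I.Boundaryless]

theorem mfderiv_extChartAt_symm_trivializationAt {M : Type*} [TopologicalSpace M]
    [ChartedSpace H M] [IsManifold I 1 M] {x₀ x : M} (hx : x ∈ (chartAt H x₀).source)
    (v : TangentSpace I x) :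
    mfderiv 𝓘(ℝ, E) I (extChartAt I x₀).symm (extChartAt I x₀ x)
      (trivializationAt E (TangentSpace I : M → Type _) x₀ ⟨x, v⟩).2 = v := by
  have h := TangentBundle.symmL_trivializationAt (I := I) hx
  rw [I.range_eq_univ, mfderivWithin_univ] at h
  refine (DFunLike.congr_fun h _).symm.trans ?_
  set e := trivializationAt E (TangentSpace I : M → Type _) x₀
  have hx' : x ∈ e.baseSet := hx
  rw [← e.continuousLinearMapAt_apply_of_mem (R := ℝ) hx']
  exact e.symmL_continuousLinearMapAt hx' v

variable {G : Type*} [TopologicalSpace G] [ChartedSpace H G] [Group G] [LieGroup I ∞ G]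
    [FiniteDimensional ℝ E]

variable (I G) in
theorem exists_curve_velocity_eq (B : E →ₗ[ℝ] E →ₗ[ℝ] E) (v : E) :
    ∃ (γ : ℝ → G) (a : ℝ → E) (ε : ℝ), 0 < ε ∧ a 0 = v ∧
      ContMDiffOn 𝓘(ℝ, ℝ) I 2 γ (Set.Ioo (-ε) ε) ∧
      ∀ t ∈ Set.Ioo (-ε) ε, HasDerivAt a (-B (a t) (a t)) t ∧
        curveVelocity I γ t = leftTranslate I (γ t) (a t) := by
  set e := trivializationAt E (TangentSpace I : G → Type _) 1 with he
  set φ := extChartAt I (1 : G) with hφ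
  let f : E × E → E × E := fun p ↦
    ((e ⟨φ.symm p.1, leftTranslate I (φ.symm p.1) p.2⟩).2, -B p.2 p.2)
  let U : Set (E × E) := φ.target ×ˢ Set.univ
  have hU : IsOpen U := (isOpen_extChartAt_target 1).prod isOpen_univ
  have hsrc (y : E) (hy : y ∈ φ.target) : φ.symm y ∈ (chartAt H (1 : G)).source := by
    have := φ.map_target hy
    rwa [hφ, extChartAt_source] at this
  have hf : ContDiffOn ℝ (2 : ℕ∞) f U := by
    refine ContDiffOn.prodMk ?_ ?_
    · rw [← contMDiffOn_iff_contDiffOn]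
      have h1 : ContMDiffOn 𝓘(ℝ, E × E) (I.prod 𝓘(ℝ, E)) 2
          (fun p : E × E ↦ (φ.symm p.1, p.2)) U :=
        ((contMDiffOn_extChartAt_symm 1).comp contDiff_fst.contMDiff.contMDiffOn
          fun p hp ↦ hp.1).prodMk contDiff_snd.contMDiff.contMDiffOn
      have h2 := contMDiff_leftTranslate.comp_contMDiffOn h1
      have h3 := (e.contMDiffOn (n := 2) (IB := I)).comp h2
        fun p hp ↦ e.mem_source.2 (hsrc p.1 hp.1)
      exact contMDiff_snd.comp_contMDiffOn h3
    · refine ContDiff.contDiffOn ?_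
      have hb := (LinearMap.toContinuousBilinearMap B).isBoundedBilinearMap.contDiff (n := 2)
      exact (hb.comp (contDiff_snd.prodMk contDiff_snd)).neg
  obtain ⟨α, ε, hε, h0, hα, hd⟩ := hf.exists_integralCurve (by norm_num) hU
    (z := (φ 1, v)) ⟨mem_extChartAt_target 1, trivial⟩
  refine ⟨fun t ↦ φ.symm (α t).1, fun t ↦ (α t).2, ε, hε, congrArg Prod.snd h0, ?_,
    fun t ht ↦ ⟨?_, ?_⟩⟩
  · refine (contMDiffOn_extChartAt_symm 1).comp (t := φ.target) ?_ fun t ht ↦ (hd t ht).1.1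
    exact (contMDiffOn_iff_contDiffOn.2 hα.fst)
  · exact (hd t ht).2.snd
  · have h1 : HasMFDerivAt 𝓘(ℝ, E) I φ.symm (α t).1 (mfderiv 𝓘(ℝ, E) I φ.symm (α t).1) := by
      refine MDifferentiableAt.hasMFDerivAt ?_
      exact ((contMDiffOn_extChartAt_symm (n := ∞) 1).contMDiffAt
        ((isOpen_extChartAt_target 1).mem_nhds (hd t ht).1.1)).mdifferentiableAt (by simp)
    have hx : HasDerivAt (fun s ↦ (α s).1) (f (α t)).1 t := (hd t ht).2.fst
    have h2 := HasMFDerivAt.comp t (f := fun s ↦ (α s).1) h1 hx.hasFDerivAt.hasMFDerivAt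
    have h3 := mfderiv_extChartAt_symm_trivializationAt (I := I)
      (hsrc _ (hd t ht).1.1) (leftTranslate I (φ.symm (α t).1) (α t).2)
    rw [← hφ, φ.right_inv (hd t ht).1.1] at h3
    refine (DFunLike.congr_fun h2.mfderiv (1 : ℝ)).trans (Eq.trans ?_ h3)
    refine congrArg (mfderiv 𝓘(ℝ, E) I φ.symm (α t).1) ?_
    exact one_smul ℝ _

end

noncomputable section

open Bundle

variable {E : Type*} [NormedAddCommGroup E] [NormedSpace ℝ E]
    {H : Type*} [TopologicalSpace H] {I : ModelWithCorners ℝ E H}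

theorem mdifferentiableAt_curveVelocity {M : Type*} [TopologicalSpace M]
    [ChartedSpace H M] [IsManifold I ∞ M] {γ : ℝ → M} {t : ℝ} (h : ContMDiffAt 𝓘(ℝ, ℝ) I 2 γ t) :
    MDifferentiableAt 𝓘(ℝ, ℝ) I.tangent
      (fun s ↦ (⟨γ s, curveVelocity I γ s⟩ : TangentBundle I M)) t := by
  refine (mdifferentiableAt_totalSpace (F := E) (IB := I) _).2
    ⟨h.mdifferentiableAt (by simp), ?_⟩
  have hφ : ContDiffAt ℝ 2 (fun s ↦ extChartAt I (γ t) (γ s)) t := by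
    rw [← contMDiffAt_iff_contDiffAt]
    exact (contMDiffAt_extChartAt (n := 2)).comp t h
  have hd : DifferentiableAt ℝ (deriv fun s ↦ extChartAt I (γ t) (γ s)) t :=
    (hφ.derivWithin (m := 1) (by norm_num)).differentiableAt (by norm_num)
  refine hd.mdifferentiableAt.congr_of_eventuallyEq ?_
  have h1 : ∀ᶠ s in 𝓝 t, ContMDiffAt 𝓘(ℝ, ℝ) I 2 γ s :=
    (contMDiffAt_iff_contMDiffAt_nhds (by simp)).1 h
  filter_upwards [h1, h.continuousAt.preimage_mem_nhds (chart_source_mem_nhds H (γ t))]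
    with s hs hs'
  have h2 := TangentBundle.continuousLinearMapAt_trivializationAt (I := I) hs'
  set e := trivializationAt E (TangentSpace I : M → Type _) (γ t)
  have hs'' : γ s ∈ e.baseSet := hs'
  have h3 := HasMFDerivAt.comp s (f := γ) (mdifferentiableAt_extChartAt hs').hasMFDerivAt
    (hs.mdifferentiableAt (by simp)).hasMFDerivAt
  rw [← e.continuousLinearMapAt_apply_of_mem (R := ℝ) hs'', h2, ← fderiv_apply_one_eq_deriv,
    ← mfderiv_eq_fderiv]
  exact (DFunLike.congr_fun h3.mfderiv (1 : ℝ)).symm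

variable {G : Type*} [TopologicalSpace G] [ChartedSpace H G] [Group G]

variable (I) in
/-- The velocity of a curve in a Lie group, translated to the identity. -/
def leftVelocity (γ : ℝ → G) (t : ℝ) : E := maurerCartan I (γ t) (curveVelocity I γ t)

theorem Filter.EventuallyEq.leftVelocity_eq {γ η : ℝ → G} {t : ℝ} (h : γ =ᶠ[𝓝 t] η) :
    leftVelocity I γ t = leftVelocity I η t := by
  have h1 : (curveVelocity I γ t : E) = curveVelocity I η t :=
    DFunLike.congr_fun (h.mfderiv_eq (I := 𝓘(ℝ, ℝ)) (I' := I)) (1 : ℝ)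
  exact congrArg₂ (fun (x : G) (v : E) ↦ maurerCartan I x v) h.eq_of_nhds h1

theorem leftVelocity_comp {η : ℝ → G} {τ : ℝ → ℝ} {t : ℝ}
    (hη : MDifferentiableAt 𝓘(ℝ, ℝ) I η (τ t)) (hτ : DifferentiableAt ℝ τ t) :
    leftVelocity I (fun s ↦ η (τ s)) t = deriv τ t • leftVelocity I η (τ t) := by
  have h := HasMFDerivAt.comp t hη.hasMFDerivAt hτ.hasDerivAt.hasFDerivAt.hasMFDerivAt
  have h1 : curveVelocity I (fun s ↦ η (τ s)) t
      = mfderiv 𝓘(ℝ, ℝ) I η (τ t) ((1 : ℝ) • deriv τ t : ℝ) :=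
    DFunLike.congr_fun h.mfderiv (1 : ℝ)
  have h2 : ((1 : ℝ) • deriv τ t : ℝ) = deriv τ t • (1 : ℝ) := by simp
  rw [leftVelocity, h1, h2]
  have h3 : mfderiv 𝓘(ℝ, ℝ) I η (τ t) (deriv τ t • (1 : ℝ) : ℝ)
    = deriv τ t • curveVelocity I η (τ t) := map_smul (mfderiv 𝓘(ℝ, ℝ) I η (τ t)) _ _
  rw [h3, map_smul]
  rfl

variable [LieGroup I ∞ G] [FiniteDimensional ℝ E]

theorem PseudoRiemannianMetric.IsGeodesicOn.hasDerivAt_leftVelocity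
    {g : PseudoRiemannianMetric I G} {B : E →ₗ[ℝ] E →ₗ[ℝ] E}
    (hB : g.IsLeviCivita (leftInvariantConnection I G B)) {γ : ℝ → G} {J : Set ℝ}
    (h : g.IsGeodesicOn γ J) {t : ℝ} (hJ : J ∈ 𝓝 t) :
    HasDerivAt (leftVelocity I γ) (-B (leftVelocity I γ t) (leftVelocity I γ t)) t := by
  obtain ⟨hγ, cov, hcov, hgeo⟩ := h
  have hd := mdifferentiableAt_curveVelocity (hγ.contMDiffAt hJ)
  have h1 := hgeo t (mem_of_mem_nhds hJ)
  rw [covDerivAlong, hcov.unique hB _ _ (FiberBundle.mdifferentiableAt_extend ..),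
    ← covDerivAlong] at h1
  have h2 := maurerCartan_covDerivAlong B hd
  rw [h1, map_zero] at h2
  have h3 : DifferentiableAt ℝ (leftVelocity I γ) t := hd.maurerCartan.differentiableAt
  have h4 : deriv (leftVelocity I γ) t = -B (leftVelocity I γ t) (leftVelocity I γ t) :=
    eq_neg_of_add_eq_zero_left h2.symm
  exact h4 ▸ h3.hasDerivAt

/-- Geodesics exist for every initial velocity at the identity. -/
theorem PseudoRiemannianMetric.exists_isGeodesicOn [I.Boundaryless]
    {g : PseudoRiemannianMetric I G} {B : E →ₗ[ℝ] E →ₗ[ℝ] E}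
    (hB : g.IsLeviCivita (leftInvariantConnection I G B)) (v : E) :
    ∃ (γ : ℝ → G) (ε : ℝ), 0 < ε ∧ leftVelocity I γ 0 = v ∧
      g.IsGeodesicOn γ (Set.Ioo (-ε) ε) := by
  obtain ⟨γ, a, ε, hε, h0, hγ, h⟩ := exists_curve_velocity_eq I G B v
  have ha (t : ℝ) (ht : t ∈ Set.Ioo (-ε) ε) : leftVelocity I γ t = a t := by
    rw [leftVelocity, (h t ht).2, maurerCartan_leftTranslate]
  refine ⟨γ, ε, hε, by rw [ha 0 ⟨by linarith, hε⟩, h0], hγ, _, hB, fun t ht ↦ ?_⟩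
  have hJ : Set.Ioo (-ε) ε ∈ 𝓝 t := isOpen_Ioo.mem_nhds ht
  have h2 := maurerCartan_covDerivAlong B (mdifferentiableAt_curveVelocity (hγ.contMDiffAt hJ))
  have h3 : deriv (leftVelocity I γ) t = -B (a t) (a t) := by
    rw [← (h t ht).1.deriv]
    exact Filter.EventuallyEq.deriv_eq (Filter.eventually_of_mem hJ ha)
  have h4 : maurerCartan I (γ t) (covDerivAlong (leftInvariantConnection I G B) γ
      (curveVelocity I γ) t) = 0 := by
    refine h2.trans ?_
    change deriv (leftVelocity I γ) t + B (leftVelocity I γ t) (leftVelocity I γ t) = 0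
    rw [h3, ha t ht, neg_add_cancel]
  rw [← leftTranslate_maurerCartan (γ t) (covDerivAlong _ _ _ _), h4, map_zero]

theorem PseudoRiemannianMetric.GeodesicallyEquivalent.exists_smul [I.Boundaryless]
    {g g' : PseudoRiemannianMetric I G} (h : g.GeodesicallyEquivalent g')
    {B B' : E →ₗ[ℝ] E →ₗ[ℝ] E} (hB : g.IsLeviCivita (leftInvariantConnection I G B))
    (hB' : g'.IsLeviCivita (leftInvariantConnection I G B')) (v : E) :
    ∃ r : ℝ, B' v v - B v v = r • v := by
  obtain ⟨γ, ε, hε, hv, hγ⟩ := PseudoRiemannianMetric.exists_isGeodesicOn hB v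
  obtain ⟨τ, η, hτ, hτ', hη, heq⟩ := h γ _ isOpen_Ioo Set.ordConnected_Ioo hγ
  have hJ (t : ℝ) (ht : t ∈ Set.Ioo (-ε) ε) : Set.Ioo (-ε) ε ∈ 𝓝 t := isOpen_Ioo.mem_nhds ht
  have hcd (t : ℝ) (ht : t ∈ Set.Ioo (-ε) ε) : ContDiffAt ℝ 2 τ t := hτ.contDiffAt (hJ t ht)
  have himg (t : ℝ) (ht : t ∈ Set.Ioo (-ε) ε) : τ '' Set.Ioo (-ε) ε ∈ 𝓝 (τ t) := by
    rw [← ((hcd t ht).hasStrictDerivAt (by simp)).map_nhds_eq (hτ' t ht)]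
    exact Filter.image_mem_map (hJ t ht)
  have h0 : (0 : ℝ) ∈ Set.Ioo (-ε) ε := ⟨by linarith, hε⟩
  have hvel (t : ℝ) (ht : t ∈ Set.Ioo (-ε) ε) :
      leftVelocity I γ t = deriv τ t • leftVelocity I η (τ t) := by
    have h1 : γ =ᶠ[𝓝 t] fun s ↦ η (τ s) := Filter.eventually_of_mem (hJ t ht) heq
    rw [h1.leftVelocity_eq, leftVelocity_comp
      ((hη.1.contMDiffAt (himg t ht)).mdifferentiableAt (by simp))
      ((hcd t ht).differentiableAt (by simp))]
  have hd1 := hγ.hasDerivAt_leftVelocity hB (hJ 0 h0)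
  have hd2 := hη.hasDerivAt_leftVelocity hB' (himg 0 h0)
  have hdτ : DifferentiableAt ℝ (deriv τ) 0 :=
    ((hcd 0 h0).derivWithin (m := 1) (by norm_num)).differentiableAt (by norm_num)
  have hd3 := hdτ.hasDerivAt.smul
    (hd2.scomp 0 ((hcd 0 h0).differentiableAt (by simp)).hasDerivAt)
  have hd4 := hd1.unique (hd3.congr_of_eventuallyEq (Filter.eventually_of_mem (hJ 0 h0) hvel))
  have hv' := hvel 0 h0
  rw [hv] at hd4 hv'
  have hne := hτ' 0 h0
  have hb : B' v v = (deriv τ 0 * deriv τ 0)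
      • B' (leftVelocity I η (τ 0)) (leftVelocity I η (τ 0)) := by
    rw [hv', map_smul, map_smul, LinearMap.smul_apply, smul_smul]
  refine ⟨deriv (deriv τ) 0 / deriv τ 0, ?_⟩
  have hr : (deriv (deriv τ) 0 / deriv τ 0) • v = deriv (deriv τ) 0 • leftVelocity I η (τ 0) := by
    rw [hv', smul_smul, div_mul_cancel₀ _ hne]
  rw [hr, hb, sub_eq_add_neg, hd4]
  simp only [Function.comp_apply]
  module

end

theorem corollary1 {E : Type*} [NormedAddCommGroup E] [NormedSpace ℝ E] [FiniteDimensional ℝ E]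
    {H : Type*} [TopologicalSpace H] (I : ModelWithCorners ℝ E H) [I.Boundaryless]
    {G : Type*} [TopologicalSpace G] [ChartedSpace H G] [Group G] [LieGroup I ∞ G]
    (g g' : PseudoRiemannianMetric I G)
    (hg : g.IsLeftInvariant) (hg' : g'.IsLeftInvariant)
    (h : g.GeodesicallyEquivalent g') :
    g.AffinelyEquivalent g' := by
  obtain ⟨B, hB, hBt, hLC⟩ := hg.exists_isLeviCivita
  obtain ⟨B', hB', hBt', hLC'⟩ := hg'.exists_isLeviCivita
  have hD : B' - B = 0 := by
    refine LinearMap.eq_zero_of_diagonal_parallel _ (fun v w ↦ ?_)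
      (fun v ↦ h.exists_smul hLC hLC' v) fun v ↦ ?_
    · have h1 := (hB' v w).trans (hB v w).symm
      simp only [LinearMap.sub_apply]
      rw [sub_eq_sub_iff_sub_eq_sub]
      exact h1
    · rw [LinearMap.sub_apply, map_sub, hBt, hBt', sub_zero]
  obtain rfl := sub_eq_zero.1 hD
  exact ⟨_, hLC, hLC'⟩
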